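/- **Proposition.** Let $(A^\bullet, F^\bullet, \hat F^\bullet, W^\bullet)$ be a $\mathbb C$-Hodge complex, that is, a bounded below complex of $\mathbb C$-vector spaces with three biregular decreasing filtrations by subcomplexes (biregular: for each $n$ there are $a,b$ such that the $a$-th step is all of $A^n$ and the $b$-th step is $0$) satisfying: 1. $A^\bullet$ has finite dimensional cohomology. 2. For each $p$, the filtrations induced by $F$ and by $\hat F$ on $Gr_W^pA=W^pA/W^{p+1}A$ are strictly preserved by the differentials, i.e. $dF^q=\mathrm{image}(d)\cap F^q$ for all $q$, and likewise for $\hat F$. 3. For all $i,p$, the space $H^i(Gr_W^pA)$ with the filtrations $\mathrm{image}[H^i(F^\bullet Gr_W^pA)\to H^i(Gr_W^pA)]$ and $\mathrm{image}[H^i(\hat F^\bullet Gr_W^pA)\to H^i(Gr_W^pA)]$ is a pure $\mathbb C$-Hodge structure of weight $i-p$. Here a pure $\mathbb C$-Hodge structure of weight $n$ is a finite dimensional $\mathbb C$-vector space $H$ with two finite decreasing filtrations $F^\bullet,\hat F^\bullet$ such that $H=F^pH\oplus\hat F^qH$ whenever $p+q=n+1$. Then for every integer $i$ the spectral sequence of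 the complex $Gr_F^iA=F^iA/F^{i+1}A$ with the filtration induced by $W$ degenerates at $E_2$: all its differentials $d_r$ with $r\ge 2$ vanish. -/

import Mathlib

open CategoryTheory

universe u

namespace HodgeCpx

/-- A decreasing filtration of a complex of complex vector spaces: for each `p` a family of
subspaces `W^p A^n ⊆ A^n`, decreasing in `p` and stable under the differentials. -/
structure Filtration (A : CochainComplex (ModuleCat.{u} ℂ) ℤ) where
  sub : ℤ → ∀ n : ℤ, Submodule ℂ (A.X n)
  anti : ∀ {p q : ℤ}, p ≤ q → ∀ n, sub q n ≤ sub p n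
  map_d : ∀ p n m : ℤ, sub p n ≤ (sub p m).comap (A.d n m).hom

namespace Filtration

variable {A : CochainComplex (ModuleCat.{u} ℂ) ℤ}

/-- In each degree `n` the filtration is everything from some index on downwards and zero
from some index on upwards. -/
def Biregular (F : Filtration A) : Prop :=
  ∀ n : ℤ, (∃ a : ℤ, F.sub a n = ⊤) ∧ (∃ b : ℤ, F.sub b n = ⊥)

/-- The differentials strictly preserve the filtration: `d F^p = image d ∩ F^p`. -/
def Strict (F : Filtration A) : Prop :=
  ∀ p n : ℤ, (F.sub p n).map (A.d n (n + 1)).hom =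
    LinearMap.range (A.d n (n + 1)).hom ⊓ F.sub p (n + 1)

/-- The subcomplex `F^p A` of `A`. -/
def subcomplex (F : Filtration A) (p : ℤ) : CochainComplex (ModuleCat.{u} ℂ) ℤ where
  X n := ModuleCat.of ℂ (F.sub p n)
  d n m := ModuleCat.ofHom ((A.d n m).hom.restrict (F.map_d p n m))
  shape n m h := by
    ext x
    simp [A.shape n m h]
  d_comp_d' i j k _ _ := by
    ext x
    exact congrArg (fun f => f.hom x.1) (A.d_comp_d i j k)

/-- The inclusion `F^p A → A`. -/
def incl (F : Filtration A) (p : ℤ) : F.subcomplex p ⟶ A where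
  f n := ModuleCat.ofHom (F.sub p n).subtype
  comm' _ _ _ := rfl

/-- The subspace `image [H^n(F^p A) → H^n(A)]` of `H^n(A)`. -/
noncomputable def onHomology (F : Filtration A) (n p : ℤ) : Submodule ℂ (A.homology n) :=
  LinearMap.range (HomologicalComplex.homologyMap (F.incl p) n).hom

/-- The complex `Gr_F^p A = F^p A / F^{p+1} A`. -/
def gr (F : Filtration A) (p : ℤ) : CochainComplex (ModuleCat.{u} ℂ) ℤ where
  X n := ModuleCat.of ℂ (F.sub p n ⧸ (F.sub (p + 1) n).comap (F.sub p n).subtype)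
  d n m := ModuleCat.ofHom (Submodule.mapQ _ _ ((A.d n m).hom.restrict (F.map_d p n m))
    (fun x hx => F.map_d (p + 1) n m hx))
  shape n m h := by
    ext x
    refine (Submodule.Quotient.mk_eq_zero _).2 ?_
    simp [A.shape n m h]
  d_comp_d' i j k _ _ := by
    ext x
    refine (Submodule.Quotient.mk_eq_zero _).2 ?_
    have h : (A.d j k).hom ((A.d i j).hom x.1) = 0 :=
      congrArg (fun f => f.hom x.1) (A.d_comp_d i j k)
    change (A.d j k).hom ((A.d i j).hom x.1) ∈ F.sub (p + 1) k
    rw [h]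
    exact Submodule.zero_mem _

/-- The filtration induced by `F` on `Gr_W^p A`: its `q`-th step is the image of
`F^q A ∩ W^p A` in `W^p A / W^{p+1} A`. -/
def inducedOnGr (F W : Filtration A) (p : ℤ) : Filtration (W.gr p) where
  sub q n := ((F.sub q n).comap (W.sub p n).subtype).map
    ((W.sub (p + 1) n).comap (W.sub p n).subtype).mkQ
  anti h n := Submodule.map_mono (Submodule.comap_mono (F.anti h n))
  map_d q n m := by
    rintro _ ⟨x, hx, rfl⟩
    exact ⟨(A.d n m).hom.restrict (W.map_d p n m) x, F.map_d q n m hx, rfl⟩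

/-! The spectral sequence of a filtered complex `(A, W)`. Terms are indexed by the page `r`, the
filtration degree `p` and the total degree `n`, so that `E_r^{p,q}` is the term with
`n = p + q` and `d_r` goes from `(p, n)` to `(p + r, n + 1)`. -/

/-- `Z_r^p = ker (W^p A^n → A^{n+1} / W^{p+r} A^{n+1})`. -/
def Z (W : Filtration A) (r p n : ℤ) : Submodule ℂ (A.X n) :=
  W.sub p n ⊓ (W.sub (p + r) (n + 1)).comap (A.d n (n + 1)).hom

/-- `W^p A^n ∩ d (W^{p-r+1} A^{n-1})`. -/
def B (W : Filtration A) (r p n : ℤ) : Submodule ℂ (A.X n) :=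
  W.sub p n ⊓ (W.sub (p - r + 1) (n - 1)).map (A.d (n - 1) n).hom

/-- The part of `Z_r^p` that is divided out in `E_r^p`, namely `B_r^p + Z_{r-1}^{p+1}`. -/
def denom (W : Filtration A) (r p n : ℤ) : Submodule ℂ (W.Z r p n) :=
  (W.B r p n ⊔ W.Z (r - 1) (p + 1) n).comap (W.Z r p n).subtype

/-- The term `E_r^{p,n-p}` of the spectral sequence. -/
abbrev E (W : Filtration A) (r p n : ℤ) : Type u := W.Z r p n ⧸ W.denom r p n

theorem d_d_apply (i j k : ℤ) (x : A.X i) : (A.d j k).hom ((A.d i j).hom x) = 0 :=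
  congrArg (fun f => f.hom x) (A.d_comp_d i j k)

theorem d_mem_Z (W : Filtration A) (r p n : ℤ) :
    ∀ x ∈ W.Z r p n, (A.d n (n + 1)).hom x ∈ W.Z r (p + r) (n + 1) := by
  rintro x ⟨_, hx⟩
  refine ⟨hx, ?_⟩
  change (A.d (n + 1) (n + 1 + 1)).hom ((A.d n (n + 1)).hom x) ∈
    W.sub (p + r + r) (n + 1 + 1)
  rw [d_d_apply]
  exact Submodule.zero_mem _

theorem d_mem_B (W : Filtration A) (r p n : ℤ) (x : A.X n) (hx : x ∈ W.sub (p + 1) n)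
    (hd : (A.d n (n + 1)).hom x ∈ W.sub (p + r) (n + 1)) :
    (A.d n (n + 1)).hom x ∈ W.B r (p + r) (n + 1) := by
  refine ⟨hd, ?_⟩
  have aux : ∀ k q : ℤ, k = n → q = p + 1 →
      (A.d n (n + 1)).hom x ∈ (W.sub q k).map (A.d k (n + 1)).hom := by
    rintro k q rfl rfl
    exact ⟨x, hx, rfl⟩
  exact aux _ _ (by ring) (by ring)

theorem denom_le (W : Filtration A) (r p n : ℤ) :
    W.denom r p n ≤ (W.denom r (p + r) (n + 1)).comap
      ((A.d n (n + 1)).hom.restrict (W.d_mem_Z r p n)) := by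
  rintro ⟨x, hxZ⟩ hx
  change (A.d n (n + 1)).hom x ∈ W.B r (p + r) (n + 1) ⊔ W.Z (r - 1) (p + r + 1) (n + 1)
  obtain ⟨y, ⟨_, w, _, rfl⟩, z, hz, hyz⟩ := Submodule.mem_sup.1 hx
  have hyz' : (A.d (n - 1) n).hom w + z = x := hyz
  refine Submodule.mem_sup_left ?_
  have hd : (A.d n (n + 1)).hom x = (A.d n (n + 1)).hom z := by
    rw [← hyz', map_add, d_d_apply, zero_add]
  have hxd : (A.d n (n + 1)).hom x ∈ W.sub (p + r) (n + 1) := hxZ.2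
  rw [hd] at hxd ⊢
  exact W.d_mem_B r p n z hz.1 hxd

/-- The differential `d_r : E_r^{p,n-p} → E_r^{p+r,n+1-(p+r)}`, induced by the differential
of `A`. -/
def dE (W : Filtration A) (r p n : ℤ) : W.E r p n →ₗ[ℂ] W.E r (p + r) (n + 1) :=
  Submodule.mapQ _ _ ((A.d n (n + 1)).hom.restrict (W.d_mem_Z r p n)) (W.denom_le r p n)

/-- The spectral sequence of `(A, W)` degenerates at `E_s`: all differentials `d_r` with
`r ≥ s` vanish. -/
def DegeneratesAt (W : Filtration A) (s : ℤ) : Prop :=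
  ∀ r : ℤ, s ≤ r → ∀ p n : ℤ, W.dE r p n = 0

end Filtration

/-- `(V, F, F')` is a pure `ℂ`-Hodge structure of weight `n`: `V` is finite dimensional, `F` and
`F'` are finite decreasing filtrations, and `V = F^p ⊕ F'^q` whenever `p + q = n + 1`. -/
structure IsPureHodgeStructure {V : Type u} [AddCommGroup V] [Module ℂ V]
    (F F' : ℤ → Submodule ℂ V) (n : ℤ) : Prop where
  finite : FiniteDimensional ℂ V
  anti : Antitone F
  anti' : Antitone F'
  bounded : (∃ a, F a = ⊤) ∧ (∃ b, F b = ⊥)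
  bounded' : (∃ a, F' a = ⊤) ∧ (∃ b, F' b = ⊥)
  opposed : ∀ p q : ℤ, p + q = n + 1 → IsCompl (F p) (F' q)

end HodgeCpx

open HodgeCpx in
/-- A `ℂ`-Hodge complex `(A, F, F', W)`; here `F'` is the filtration usually written `F` with a
bar or a hat. -/
structure CHodgeComplex where
  A : CochainComplex (ModuleCat.{u} ℂ) ℤ
  F : Filtration A
  F' : Filtration A
  W : Filtration A
  bounded_below : ∃ m : ℤ, ∀ n < m, Subsingleton (A.X n)
  biregular_F : F.Biregular
  biregular_F' : F'.Biregular
  biregular_W : W.Biregular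
  finite_homology : ∀ n : ℤ, FiniteDimensional ℂ (A.homology n)
  strict_F : ∀ p : ℤ, (F.inducedOnGr W p).Strict
  strict_F' : ∀ p : ℤ, (F'.inducedOnGr W p).Strict
  hodge : ∀ i p : ℤ, IsPureHodgeStructure
    ((F.inducedOnGr W p).onHomology i) ((F'.inducedOnGr W p).onHomology i) (i - p)

/-! The reason is weights: `d_r` goes from a subquotient of `H^n(Gr_W^p)`, of weight `n - p`, to one
of `H^{n+1}(Gr_W^{p+r})`, of weight `n - p - r + 1`. So `d_1` respects Hodge types, while for `r ≥
2` the weight drops: a class in `F^a ∩ F'^b` with `a + b = n - p` lands in `F^a ∩ F'^b` of a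
structure of weight less than `a + b`, which is zero.

No spectral sequence of Hodge structures is built; the argument works with elements of `A`.
`StrictOnGr` and `OpposedOnGr` express the hypotheses this way. Induction on `r`, for both
filtrations at once (`VanishesBelow.succ`), shows that the spectral sequence of each `(F^a A, W)`
degenerates at `E_2`. In `exists_diff_sub_mem` strictness and one more splitting by type carry this
over to `Gr_F^i A`. -/

namespace HodgeCpx

/-! ### Homology classes in terms of elements. -/

section Homology

variable {K K₁ K₂ : CochainComplex (ModuleCat.{u} ℂ) ℤ}

theorem exists_cycle {n : ℤ} (x : K.X n) (hx : (K.d n (n + 1)).hom x = 0) :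
    ∃ z : K.cycles n, (K.iCycles n).hom z = x := by
  have h : (ShortComplex.mk (K.iCycles n) (K.d n (n + 1)) (by simp)).Exact :=
    ShortComplex.exact_of_f_is_kernel _ (K.cyclesIsKernel n (n + 1) (by simp))
  exact (ShortComplex.moduleCat_exact_iff _).1 h x hx

theorem d_iCycles_apply {n : ℤ} (z : K.cycles n) :
    (K.d n (n + 1)).hom ((K.iCycles n).hom z) = 0 :=
  congrArg (fun f => f.hom z) (K.iCycles_d n (n + 1))

theorem exists_eq_d_of_homologyπ_eq_zero {m n : ℤ} (hmn : m + 1 = n) (z : K.cycles n)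
    (hz : (K.homologyπ n).hom z = 0) :
    ∃ y : K.X m, (K.d m n).hom y = (K.iCycles n).hom z := by
  have hm : (ComplexShape.up ℤ).prev n = m := by simp [← hmn]
  have h : (ShortComplex.mk (K.toCycles m n) (K.homologyπ n) (by simp)).Exact :=
    ShortComplex.exact_of_g_is_cokernel _ (K.homologyIsCokernel m n hm)
  obtain ⟨y, hy⟩ := (ShortComplex.moduleCat_exact_iff _).1 h z hz
  refine ⟨y, ?_⟩
  have h' : (K.toCycles m n ≫ K.iCycles n).hom y = (K.d m n).hom y := by
    rw [K.toCycles_i]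
  rw [← h', ← hy]
  rfl

theorem homologyπ_eq_zero_of_eq_d {m n : ℤ} (z : K.cycles n) (y : K.X m)
    (hy : (K.d m n).hom y = (K.iCycles n).hom z) : (K.homologyπ n).hom z = 0 := by
  have h : (K.toCycles m n).hom y = z := by
    apply (ModuleCat.mono_iff_injective (K.iCycles n)).1 inferInstance
    rw [← hy, ← K.toCycles_i]
    rfl
  rw [← h]
  exact congrArg (fun f => f.hom y) (K.toCycles_comp_homologyπ m n)

theorem homologyπ_surjective (n : ℤ) : Function.Surjective (K.homologyπ n).hom :=
  (ModuleCat.epi_iff_surjective (K.homologyπ n)).1 inferInstance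

theorem homologyMap_π_apply (φ : K₁ ⟶ K) {n : ℤ} (z : K₁.cycles n) :
    (HomologicalComplex.homologyMap φ n).hom ((K₁.homologyπ n).hom z) =
      (K.homologyπ n).hom ((HomologicalComplex.cyclesMap φ n).hom z) :=
  congrArg (fun f => f.hom z) (HomologicalComplex.homologyπ_naturality φ n)

theorem iCycles_cyclesMap_apply (φ : K₁ ⟶ K) {n : ℤ} (z : K₁.cycles n) :
    (K.iCycles n).hom ((HomologicalComplex.cyclesMap φ n).hom z) =
      (φ.f n).hom ((K₁.iCycles n).hom z) :=
  congrArg (fun f => f.hom z) (HomologicalComplex.cyclesMap_i φ n)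

/-- If the images of `H^n(K₁)` and `H^n(K₂)` span `H^n(K)`, every cycle of `K` is a sum of
images of cycles up to a boundary. -/
theorem exists_cycles_add (φ : K₁ ⟶ K) (ψ : K₂ ⟶ K) {m n : ℤ} (hmn : m + 1 = n)
    (h : LinearMap.range (HomologicalComplex.homologyMap φ n).hom ⊔
      LinearMap.range (HomologicalComplex.homologyMap ψ n).hom = ⊤)
    (x : K.X n) (hx : (K.d n (n + 1)).hom x = 0) :
    ∃ x₁ x₂ y, (K₁.d n (n + 1)).hom x₁ = 0 ∧ (K₂.d n (n + 1)).hom x₂ = 0 ∧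
      x = (φ.f n).hom x₁ + (ψ.f n).hom x₂ + (K.d m n).hom y := by
  obtain ⟨z, rfl⟩ := exists_cycle x hx
  have hz : (K.homologyπ n).hom z ∈ LinearMap.range (HomologicalComplex.homologyMap φ n).hom ⊔
      LinearMap.range (HomologicalComplex.homologyMap ψ n).hom := h ▸ Submodule.mem_top
  obtain ⟨_, ⟨c₁, rfl⟩, _, ⟨c₂, rfl⟩, hc⟩ := Submodule.mem_sup.1 hz
  obtain ⟨z₁, rfl⟩ := homologyπ_surjective n c₁
  obtain ⟨z₂, rfl⟩ := homologyπ_surjective n c₂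
  rw [homologyMap_π_apply, homologyMap_π_apply, ← map_add, eq_comm, ← sub_eq_zero,
    ← map_sub] at hc
  obtain ⟨y, hy⟩ := exists_eq_d_of_homologyπ_eq_zero hmn _ hc
  refine ⟨_, _, y, d_iCycles_apply z₁, d_iCycles_apply z₂, ?_⟩
  rw [hy, map_sub, map_add, iCycles_cyclesMap_apply, iCycles_cyclesMap_apply]
  abel

/-- If the images of `H^n(K₁)` and `H^n(K₂)` in `H^n(K)` intersect trivially, then cycles whose
images add up to a boundary have themselves boundaries as images. -/
theorem exists_eq_d_of_add_eq_d (φ : K₁ ⟶ K) (ψ : K₂ ⟶ K) {m n : ℤ} (hmn : m + 1 = n)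
    (h : Disjoint (LinearMap.range (HomologicalComplex.homologyMap φ n).hom)
      (LinearMap.range (HomologicalComplex.homologyMap ψ n).hom))
    (x₁ : K₁.X n) (x₂ : K₂.X n) (y : K.X m) (h₁ : (K₁.d n (n + 1)).hom x₁ = 0)
    (h₂ : (K₂.d n (n + 1)).hom x₂ = 0)
    (hy : (φ.f n).hom x₁ + (ψ.f n).hom x₂ = (K.d m n).hom y) :
    ∃ y', (K.d m n).hom y' = (φ.f n).hom x₁ := by
  obtain ⟨z₁, rfl⟩ := exists_cycle x₁ h₁
  obtain ⟨z₂, rfl⟩ := exists_cycle x₂ h₂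
  rw [← iCycles_cyclesMap_apply, ← iCycles_cyclesMap_apply, ← map_add] at hy
  have hs := homologyπ_eq_zero_of_eq_d _ y hy.symm
  rw [map_add, ← homologyMap_π_apply, ← homologyMap_π_apply] at hs
  have h0 := (Submodule.disjoint_def.1 h) _ ⟨_, rfl⟩
    ⟨-(K₂.homologyπ n).hom z₂, by rw [map_neg]; exact (eq_neg_of_add_eq_zero_left hs).symm⟩
  rw [homologyMap_π_apply] at h0
  obtain ⟨y', hy'⟩ := exists_eq_d_of_homologyπ_eq_zero hmn _ h0
  exact ⟨y', hy'.trans (iCycles_cyclesMap_apply φ z₁)⟩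

end Homology

/-! ### Strictness and opposedness in terms of elements of `A`. -/

namespace Filtration

variable {A : CochainComplex (ModuleCat.{u} ℂ) ℤ}

/-- The differential `A^n → A^{n+1}`. -/
def diff (A : CochainComplex (ModuleCat.{u} ℂ) ℤ) (n : ℤ) : A.X n →ₗ[ℂ] A.X (n + 1) :=
  (A.d n (n + 1)).hom

theorem diff_diff (n : ℤ) (x : A.X n) : diff A (n + 1) (diff A n x) = 0 :=
  d_d_apply n (n + 1) (n + 1 + 1) x

theorem diff_mem (F : Filtration A) {p n : ℤ} {x : A.X n} (hx : x ∈ F.sub p n) :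
    diff A n x ∈ F.sub p (n + 1) :=
  F.map_d p n (n + 1) hx

theorem mem_of_le (F : Filtration A) {p q n : ℤ} (h : p ≤ q) {x : A.X n} (hx : x ∈ F.sub q n) :
    x ∈ F.sub p n :=
  F.anti h n hx

/-- Strictness with respect to `F` of the differentials of all `Gr_W^p A`, in terms of elements
of `A`. -/
def StrictOnGr (F W : Filtration A) : Prop :=
  ∀ a p n : ℤ, ∀ x ∈ F.sub a (n + 1), ∀ y ∈ W.sub p n, x - diff A n y ∈ W.sub (p + 1) (n + 1) →
    ∃ y' ∈ F.sub a n ⊓ W.sub p n, x - diff A n y' ∈ W.sub (p + 1) (n + 1)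

theorem strictOnGr_of_strict {F W : Filtration A} (h : ∀ p, (F.inducedOnGr W p).Strict) :
    F.StrictOnGr W := by
  intro a p n x hx y hy hxy
  have hxW : x ∈ W.sub p (n + 1) := by
    have := add_mem (W.mem_of_le (by lia) hxy) (W.diff_mem hy)
    rwa [sub_add_cancel] at this
  have hmem : (Submodule.Quotient.mk ⟨x, hxW⟩ : (W.gr p).X (n + 1)) ∈
      LinearMap.range ((W.gr p).d n (n + 1)).hom ⊓ (F.inducedOnGr W p).sub a (n + 1) := by
    refine ⟨⟨Submodule.Quotient.mk ⟨y, hy⟩, ?_⟩, ⟨⟨x, hxW⟩, hx, rfl⟩⟩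
    refine (Submodule.Quotient.eq _).2 ?_
    have := neg_mem hxy
    rw [neg_sub] at this
    exact this
  rw [← h p a n] at hmem
  obtain ⟨_, ⟨⟨y', hyW⟩, hyF, rfl⟩, hy'⟩ := hmem
  refine ⟨y', ⟨hyF, hyW⟩, ?_⟩
  have := neg_mem ((Submodule.Quotient.eq _).1 hy')
  rw [neg_sub] at this
  exact this

theorem gr_mk_eq_iff (W : Filtration A) {p n : ℤ} (x y : W.sub p n) :
    (Submodule.Quotient.mk x : W.sub p n ⧸ (W.sub (p + 1) n).comap (W.sub p n).subtype) =
      Submodule.Quotient.mk y ↔ (x : A.X n) - y ∈ W.sub (p + 1) n :=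
  Submodule.Quotient.eq _

theorem gr_mk_eq_zero_iff (W : Filtration A) {p n : ℤ} (x : W.sub p n) :
    (Submodule.Quotient.mk x : W.sub p n ⧸ (W.sub (p + 1) n).comap (W.sub p n).subtype) = 0 ↔
      (x : A.X n) ∈ W.sub (p + 1) n :=
  Submodule.Quotient.mk_eq_zero _

/-- In terms of elements of `A`: the filtrations induced by `F` and `G` on `H^n(Gr_W^p A)` are
opposed of weight `n - p`. -/
structure OpposedOnGr (F G W : Filtration A) : Prop where
  span : ∀ a b p n : ℤ, a + b = n - p + 1 → ∀ x ∈ W.sub p n, diff A n x ∈ W.sub (p + 1) (n + 1) →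
    ∃ x₁ ∈ F.sub a n ⊓ W.sub p n, ∃ x₂ ∈ G.sub b n ⊓ W.sub p n, ∃ w ∈ W.sub (p + 1) n,
      diff A n x₁ ∈ W.sub (p + 1) (n + 1) ∧ diff A n x₂ ∈ W.sub (p + 1) (n + 1) ∧
      diff A n x = diff A n x₁ + diff A n x₂ + diff A n w
  disjoint : ∀ a b p n : ℤ, a + b = n + 1 - p + 1 → ∀ x₁ ∈ F.sub a (n + 1) ⊓ W.sub p (n + 1),
    ∀ x₂ ∈ G.sub b (n + 1) ⊓ W.sub p (n + 1), ∀ y ∈ W.sub p n,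
    diff A (n + 1) x₁ ∈ W.sub (p + 1) (n + 1 + 1) →
    diff A (n + 1) x₂ ∈ W.sub (p + 1) (n + 1 + 1) →
    x₁ + x₂ - diff A n y ∈ W.sub (p + 1) (n + 1) →
    (∃ y₁ ∈ F.sub a n ⊓ W.sub p n, x₁ - diff A n y₁ ∈ W.sub (p + 1) (n + 1)) ∧
    (∃ y₂ ∈ G.sub b n ⊓ W.sub p n, x₂ - diff A n y₂ ∈ W.sub (p + 1) (n + 1))

/-- Opposedness on homology only gives boundaries from `Gr_W^p A`; strictness moves their primitives
into `F` and `G`. -/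
theorem opposedOnGr_of_isCompl {F G W : Filtration A} (hF : F.StrictOnGr W)
    (hG : G.StrictOnGr W)
    (h : ∀ a b p n : ℤ, a + b = n - p + 1 →
      IsCompl ((F.inducedOnGr W p).onHomology n a) ((G.inducedOnGr W p).onHomology n b)) :
    F.OpposedOnGr G W where
  span a b p n hab x hx hdx := by
    obtain ⟨⟨_, ⟨x₁, hx₁W⟩, hx₁F, rfl⟩, ⟨_, ⟨x₂, hx₂W⟩, hx₂G, rfl⟩, y, h₁, h₂, he⟩ :=
      exists_cycles_add ((F.inducedOnGr W p).incl a) ((G.inducedOnGr W p).incl b)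
        (sub_add_cancel n 1) (codisjoint_iff.1 (h a b p n hab).codisjoint)
        (Submodule.Quotient.mk ⟨x, hx⟩) ((Submodule.Quotient.mk_eq_zero _).2 hdx)
    obtain ⟨⟨y, hy⟩, rfl⟩ := Submodule.Quotient.mk_surjective _ y
    have hw : x - (x₁ + x₂ + (A.d (n - 1) n).hom y) ∈ W.sub (p + 1) n :=
      (W.gr_mk_eq_iff ⟨x, hx⟩ ⟨x₁ + x₂ + (A.d (n - 1) n).hom y,
        add_mem (add_mem hx₁W hx₂W) (W.map_d p (n - 1) n hy)⟩).1 he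
    refine ⟨x₁, ⟨hx₁F, hx₁W⟩, x₂, ⟨hx₂G, hx₂W⟩, _, hw, ?_, ?_, ?_⟩
    · exact (W.gr_mk_eq_zero_iff ⟨diff A n x₁, W.diff_mem hx₁W⟩).1 (congrArg Subtype.val h₁)
    · exact (W.gr_mk_eq_zero_iff ⟨diff A n x₂, W.diff_mem hx₂W⟩).1 (congrArg Subtype.val h₂)
    -- Comparing differentials rather than elements makes the boundary from degree `n - 1`
    -- disappear.
    · have hd : diff A n ((A.d (n - 1) n).hom y) = 0 := d_d_apply (n - 1) n (n + 1) y
      rw [map_sub, map_add, map_add, hd]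
      abel
  disjoint a b p n hab x₁ hx₁ x₂ hx₂ y hy h₁ h₂ hxy := by
    obtain ⟨y₁, hy₁⟩ := exists_eq_d_of_add_eq_d ((F.inducedOnGr W p).incl a)
      ((G.inducedOnGr W p).incl b) rfl (h a b p (n + 1) hab).disjoint
      ⟨Submodule.Quotient.mk ⟨x₁, hx₁.2⟩, ⟨x₁, hx₁.2⟩, hx₁.1, rfl⟩
      ⟨Submodule.Quotient.mk ⟨x₂, hx₂.2⟩, ⟨x₂, hx₂.2⟩, hx₂.1, rfl⟩
      (Submodule.Quotient.mk ⟨y, hy⟩)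
      (Subtype.ext ((Submodule.Quotient.mk_eq_zero _).2 h₁))
      (Subtype.ext ((Submodule.Quotient.mk_eq_zero _).2 h₂))
      ((Submodule.Quotient.eq _).2 hxy)
    obtain ⟨⟨y₁, hyW⟩, rfl⟩ := Submodule.Quotient.mk_surjective _ y₁
    have hmem : diff A n y₁ - x₁ ∈ W.sub (p + 1) (n + 1) :=
      (W.gr_mk_eq_iff ⟨diff A n y₁, W.diff_mem hyW⟩ ⟨x₁, hx₁.2⟩).1 hy₁
    constructor
    · refine hF a p n x₁ hx₁.1 y₁ hyW ?_
      rw [← neg_sub]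
      exact neg_mem hmem
    -- Modulo `W^{p+1}`, `x₁ + x₂ = dy` and `x₁ = dy₁`, so `x₂ = d(y - y₁)`.
    · refine hG b p n x₂ hx₂.1 (y - y₁) (sub_mem hy hyW) ?_
      have := add_mem hxy hmem
      rw [map_sub]
      convert this using 1
      abel

theorem OpposedOnGr.symm {F G W : Filtration A} (h : F.OpposedOnGr G W) : G.OpposedOnGr F W where
  span a b p n hab x hx hdx := by
    obtain ⟨x₁, h₁, x₂, h₂, w, hw, hd₁, hd₂, he⟩ := h.span b a p n (by lia) x hx hdx
    exact ⟨x₂, h₂, x₁, h₁, w, hw, hd₂, hd₁, by rw [he]; abel⟩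
  disjoint a b p n hab x₁ hx₁ x₂ hx₂ y hy h₁ h₂ hxy :=
    (h.disjoint b a p n (by lia) x₂ hx₂ x₁ hx₁ y hy h₂ h₁ (by rwa [add_comm x₂])).symm

/-! ### Degeneration for the subcomplexes `F^a A`. -/

/-- The differentials `d_2, …, d_{r-1}` of the spectral sequences of all `(F^a A, W)` vanish. -/
def VanishesBelow (F W : Filtration A) (r : ℤ) : Prop :=
  ∀ a p n : ℤ, ∀ x ∈ F.sub a n ⊓ W.sub p n, diff A n x ∈ W.sub (p + 2) (n + 1) →
    ∃ w ∈ F.sub a n ⊓ W.sub (p + 1) n, diff A n (x - w) ∈ W.sub (p + r) (n + 1)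

theorem vanishesBelow_two (F W : Filtration A) : F.VanishesBelow W 2 :=
  fun _ _ _ x _ hdx => ⟨0, zero_mem _, by rwa [sub_zero]⟩

/-- If `d_2, …, d_{r-1}` vanish, then a boundary in `W^P` of an element of `W^{P-s}`, `s < r`, is,
modulo `W^{P+1}`, the boundary of an element of `W^{P-1}`. -/
theorem VanishesBelow.exists_sub_mem {F W : Filtration A} {r : ℤ} (h : F.VanishesBelow W r)
    (hF : F.Biregular) (n P : ℤ) (s : ℕ) (hs : 1 ≤ s) :
    s + 1 ≤ r → ∀ x ∈ W.sub (P - s) n, diff A n x ∈ W.sub P (n + 1) →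
    ∃ w ∈ W.sub (P - 1) n, diff A n x - diff A n w ∈ W.sub (P + 1) (n + 1) := by
  induction s, hs using Nat.le_induction with
  | base => exact fun _ x hx _ => ⟨x, by simpa using hx, by simp⟩
  | succ s hs ih =>
    intro hr x hx hdx
    -- Where `F^a A^n` is everything, the vanishing applies to arbitrary elements of `A^n`.
    obtain ⟨a, ha⟩ := (hF n).1
    push_cast at hr hx
    obtain ⟨w, hw, hdw⟩ := h a _ n x ⟨ha ▸ Submodule.mem_top, hx⟩ (W.mem_of_le (by lia) hdx)
    have hdw' := W.mem_of_le (p := P + 1) (by lia) hdw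
    have hdwP : diff A n w ∈ W.sub P (n + 1) := by
      have := sub_mem hdx (W.mem_of_le (by lia) hdw')
      rwa [map_sub, sub_sub_cancel] at this
    obtain ⟨w', hw', hd⟩ := ih (by lia) w (W.mem_of_le (by lia) hw.2) hdwP
    refine ⟨w', hw', ?_⟩
    have := add_mem hdw' hd
    rwa [map_sub, sub_add_sub_cancel] at this

/-- The weight argument: `x` and `x₂` represent one class, seen in `F^a` and in `G^b` with `a + b =
n - p`. Its `d_r` is therefore of both types, and opposedness kills it once the indeterminacy, an
image of `d_1`, is split by type. -/
theorem VanishesBelow.step_of_sub {F G W : Filtration A} {r : ℤ} (hr : 2 ≤ r)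
    (h : F.OpposedOnGr G W) (hF : F.VanishesBelow W r) (hG : G.VanishesBelow W r)
    (hFb : F.Biregular) {a b p n : ℤ} (hab : a + b = n - p) {x x₂ w₀ : A.X n}
    (hx : x ∈ F.sub a n ⊓ W.sub p n) (hdx : diff A n x ∈ W.sub (p + 2) (n + 1))
    (hx₂ : x₂ ∈ G.sub b n ⊓ W.sub p n) (hdx₂ : diff A n x₂ ∈ W.sub (p + 2) (n + 1))
    (hw₀ : w₀ ∈ W.sub (p + 1) n) (he : diff A n x = diff A n x₂ + diff A n w₀) :
    ∃ w ∈ F.sub a n ⊓ W.sub (p + 1) n, diff A n (x - w) ∈ W.sub (p + (r + 1)) (n + 1) := by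
  obtain ⟨u, hu, hdu⟩ := hF a p n x hx hdx
  obtain ⟨u₂, hu₂, hdu₂⟩ := hG b p n x₂ hx₂ hdx₂
  -- The discrepancy `w₀ + u₂ - u` lies in `W^{p+1}`, which is `r - 1` steps below `W^{p+r}`.
  obtain ⟨s, hs⟩ : ∃ s : ℕ, (s : ℤ) = r - 1 := ⟨(r - 1).toNat, by lia⟩
  have hv : w₀ + u₂ - u ∈ W.sub (p + r - s) n :=
    W.mem_of_le (by lia) (sub_mem (add_mem hw₀ hu₂.2) hu.2)
  have hdv : diff A n (w₀ + u₂ - u) = diff A n (x - u) - diff A n (x₂ - u₂) := by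
    simp only [map_add, map_sub, he]
    abel
  obtain ⟨w, hw, hdw⟩ := hF.exists_sub_mem hFb n (p + r) s (by lia) (by lia) _ hv
    (hdv ▸ sub_mem hdu hdu₂)
  have hdwP : diff A n w ∈ W.sub (p + r - 1 + 1) (n + 1) := by
    have := sub_mem (hdv ▸ sub_mem hdu hdu₂) (W.mem_of_le (by lia) hdw)
    rw [sub_sub_cancel] at this
    exact W.mem_of_le (by lia) this
  -- `H^n(Gr_W^{p+r-1})` and `H^{n+1}(Gr_W^{p+r})` have the same weight, so one index complementary
  -- to `a` serves both. It equals `b - r + 2`, which is at most `b` exactly because `r ≥ 2`.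
  obtain ⟨w₁, hw₁, w₂, hw₂, w₃, hw₃, hd₁, hd₂, hd⟩ :=
    h.span a (n - (p + r) + 2 - a) (p + r - 1) n (by lia) w hw hdwP
  rw [sub_add_cancel] at hw₃ hd₁ hd₂
  obtain ⟨⟨t, ht, hdt⟩, -⟩ := h.disjoint a (n - (p + r) + 2 - a) (p + r) n (by lia)
    (diff A n (x - u) - diff A n w₁)
    ⟨sub_mem (F.diff_mem (sub_mem hx.1 hu.1)) (F.diff_mem hw₁.1), sub_mem hdu hd₁⟩
    (-(diff A n (x₂ - u₂) + diff A n w₂))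
    ⟨neg_mem (add_mem (G.diff_mem (G.mem_of_le (by lia) (sub_mem hx₂.1 hu₂.1)))
      (G.diff_mem hw₂.1)), neg_mem (add_mem hdu₂ hd₂)⟩ w₃ hw₃
    (by simp [diff_diff]) (by simp only [map_neg, map_add, diff_diff]; simp)
    (by
      convert hdw using 1
      rw [hdv, hd]
      abel)
  refine ⟨u + w₁ + t, ⟨add_mem (add_mem hu.1 hw₁.1) ht.1,
    add_mem (add_mem hu.2 (W.mem_of_le (by lia) hw₁.2)) (W.mem_of_le (by lia) ht.2)⟩, ?_⟩
  rw [← add_assoc]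
  convert hdt using 1
  simp only [map_sub, map_add]
  abel

/-- Descending induction on `a`, starting where `F^a A^n = 0`: a part of `x` in `F^{a+1}` is split
off, and the rest has the differential of an element of `G^{n-p-a}` up to `d W^{p+1}`. -/
theorem VanishesBelow.succ {F G W : Filtration A} {r : ℤ} (hr : 2 ≤ r)
    (h : F.OpposedOnGr G W) (hF : F.VanishesBelow W r) (hG : G.VanishesBelow W r)
    (hFb : F.Biregular) : F.VanishesBelow W (r + 1) := by
  intro a p n
  obtain ⟨c, hc⟩ := (hFb n).2
  have hzero : ∀ x ∈ F.sub c n, x = 0 := fun x hx => by simpa [hc] using hx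
  obtain ⟨k, hk⟩ : ∃ k : ℕ, c ≤ a + k := ⟨(c - a).toNat, by lia⟩
  induction k generalizing a with
  | zero =>
    intro x hx _
    rw [hzero x (F.mem_of_le (by simpa using hk) hx.1)]
    exact ⟨0, zero_mem _, by simp⟩
  | succ k ih =>
    intro x hx hdx
    obtain ⟨x₁, hx₁, x₂, hx₂, w₀, hw₀, hd₁, hd₂, he⟩ :=
      h.span (a + 1) (n - p - a) p n (by lia) x hx.2 (W.mem_of_le (by lia) hdx)
    have htwo : W.sub (p + 2) (n + 1) = W.sub (p + 1 + 1) (n + 1) := by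
      rw [add_assoc]; rfl
    -- `d_1` preserves weight, so the same indices are opposed in the target; as `dx ∈ W^{p+2}`,
    -- both parts are `d_1`-closed and can be corrected to have differential in `W^{p+2}`.
    obtain ⟨⟨y₁, hy₁, hdy₁⟩, ⟨y₂, hy₂, hdy₂⟩⟩ := h.disjoint (a + 1) (n - p - a) (p + 1) n (by lia)
      (diff A n x₁) ⟨F.diff_mem hx₁.1, hd₁⟩ (diff A n x₂) ⟨G.diff_mem hx₂.1, hd₂⟩
      (-w₀) (neg_mem hw₀) (by simp [diff_diff]) (by simp [diff_diff])
      (by rwa [map_neg, sub_neg_eq_add, ← he, ← htwo])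
    rw [← map_sub, ← htwo] at hdy₁ hdy₂
    have hz₁ : x₁ - y₁ ∈ F.sub (a + 1) n ⊓ W.sub p n :=
      ⟨sub_mem hx₁.1 hy₁.1, sub_mem hx₁.2 (W.mem_of_le (by lia) hy₁.2)⟩
    obtain ⟨v, hv, hdv⟩ := ih (a + 1) (by push_cast at hk; lia) _ hz₁ hdy₁
    obtain ⟨w, hw, hdw⟩ := step_of_sub hr h hF hG hFb (a := a) (b := n - p - a) (by lia)
      (x := x - (x₁ - y₁)) (x₂ := x₂ - y₂) (w₀ := w₀ + y₁ + y₂)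
      ⟨sub_mem hx.1 (F.mem_of_le (by lia) hz₁.1), sub_mem hx.2 hz₁.2⟩
      (by rw [map_sub]; exact sub_mem hdx hdy₁)
      ⟨sub_mem hx₂.1 hy₂.1, sub_mem hx₂.2 (W.mem_of_le (by lia) hy₂.2)⟩ hdy₂
      (add_mem (add_mem hw₀ hy₁.2) hy₂.2)
      (by simp only [map_sub, map_add, he]; abel)
    refine ⟨v + w, ⟨add_mem (F.mem_of_le (by lia) hv.1) hw.1, add_mem hv.2 hw.2⟩, ?_⟩
    convert add_mem hdv hdw using 1
    simp only [map_sub, map_add]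
    abel

theorem OpposedOnGr.vanishesBelow {F G W : Filtration A} (h : F.OpposedOnGr G W)
    (hF : F.Biregular) (hG : G.Biregular) (k : ℕ) :
    F.VanishesBelow W (2 + k) ∧ G.VanishesBelow W (2 + k) := by
  induction k with
  | zero => exact ⟨by simpa using F.vanishesBelow_two W, by simpa using G.vanishesBelow_two W⟩
  | succ k ih =>
    push_cast
    rw [← add_assoc]
    -- The step for each filtration uses the vanishing for the other, hence the joint induction.
    exact ⟨ih.1.succ (by lia) h ih.2 hF, ih.2.succ (by lia) h.symm ih.1 hG⟩

/-- The spectral sequence of every `(F^a A, W)` degenerates at `E_2`. -/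
theorem OpposedOnGr.exists_diff_eq {F G W : Filtration A} (h : F.OpposedOnGr G W)
    (hF : F.Biregular) (hG : G.Biregular) (hW : W.Biregular) (a p n : ℤ) (x : A.X n)
    (hx : x ∈ F.sub a n ⊓ W.sub p n) (hdx : diff A n x ∈ W.sub (p + 2) (n + 1)) :
    ∃ w ∈ F.sub a n ⊓ W.sub (p + 1) n, diff A n x = diff A n w := by
  obtain ⟨c, hc⟩ := (hW (n + 1)).2
  -- This page is late enough that `W^{p+r} A^{n+1} ⊆ W^c A^{n+1} = 0`.
  obtain ⟨w, hw, hdw⟩ := (h.vanishesBelow hF hG (c - p).toNat).1 a p n x hx hdx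
  have h0 : diff A n (x - w) ∈ W.sub c (n + 1) := W.mem_of_le (by lia) hdw
  rw [hc, Submodule.mem_bot, map_sub, sub_eq_zero] at h0
  exact ⟨w, hw, h0⟩

/-! ### Passage from `F^i A` to `Gr_F^i A`. -/

/-- Elements of `F^i A ∩ W^p A` whose differential lies in `W^{p+2}` modulo `F^{i+1}` have, modulo
`F^{i+1}`, the same differential as an element of `F^i A ∩ W^{p+1} A`. -/
theorem OpposedOnGr.exists_diff_sub_mem {F G W : Filtration A} (h : F.OpposedOnGr G W)
    (hS : F.StrictOnGr W) (hF : F.Biregular) (hG : G.Biregular) (hW : W.Biregular)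
    (i p n : ℤ) (x : A.X n) (hx : x ∈ F.sub i n ⊓ W.sub p n) (z : A.X (n + 1))
    (hz : z ∈ W.sub (p + 2) (n + 1)) (hxz : diff A n x - z ∈ F.sub (i + 1) (n + 1)) :
    ∃ w ∈ F.sub i n ⊓ W.sub (p + 1) n, diff A n x - diff A n w ∈ F.sub (i + 1) (n + 1) := by
  have htwo : p + 2 = p + 1 + 1 := by ring
  -- The plan is to change `x` by `y`, `f`, `t`, all in `F^{i+1}`, until its differential lies in
  -- `W^{p+2}`. Strictness gives `y`, making `x - y` a cycle in `Gr_W^p`.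
  obtain ⟨y, hy, hdy⟩ := hS (i + 1) p n _ hxz x hx.2
    (by rw [sub_sub_cancel_left]; exact neg_mem (W.mem_of_le (by lia) hz))
  have hdxy : diff A n (x - y) ∈ W.sub (p + 1) (n + 1) := by
    convert add_mem hdy (W.mem_of_le (p := p + 1) (by lia) hz) using 1
    rw [map_sub]
    abel
  obtain ⟨f, hf, g, hg, w, hw, hdf, hdg, hd⟩ :=
    h.span (i + 1) (n - p - i) p n (by lia) (x - y) (sub_mem hx.2 hy.2) hdxy
  -- The element of `F^{i+1}` and `-dg` add up to `dw - z`, a boundary modulo `W^{p+2}`, so the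
  -- first is itself a boundary `dt` there.
  obtain ⟨⟨t, ht, hdt⟩, -⟩ := h.disjoint (i + 1) (n - p - i) (p + 1) n (by lia)
    (diff A n x - z - diff A n y - diff A n f)
    ⟨sub_mem (sub_mem hxz (F.diff_mem hy.1)) (F.diff_mem hf.1), sub_mem hdy hdf⟩
    (-diff A n g) ⟨neg_mem (G.diff_mem hg.1), neg_mem hdg⟩ w hw
    (by
      simp only [map_sub, diff_diff, zero_sub, sub_zero]
      exact neg_mem (W.diff_mem (htwo ▸ hz)))
    (by simp [diff_diff])
    (by
      convert neg_mem (htwo ▸ hz) using 1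
      have hd' := hd
      rw [map_sub, sub_eq_iff_eq_add] at hd'
      rw [hd']
      abel)
  obtain ⟨v, hv, hdv⟩ := h.exists_diff_eq hF hG hW i p n (x - y - f - t)
    ⟨sub_mem (sub_mem (sub_mem hx.1 (F.mem_of_le (by lia) hy.1)) (F.mem_of_le (by lia) hf.1))
      (F.mem_of_le (by lia) ht.1),
      sub_mem (sub_mem (sub_mem hx.2 hy.2) hf.2) (W.mem_of_le (by lia) ht.2)⟩
    (by
      rw [← htwo] at hdt
      convert add_mem hdt hz using 1
      simp only [map_sub]
      abel)
  refine ⟨v, hv, ?_⟩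
  rw [← hdv]
  convert add_mem (add_mem (F.diff_mem hy.1) (F.diff_mem hf.1)) (F.diff_mem ht.1) using 1
  simp only [map_sub]
  abel

/-- The spectral sequence of `(A, V)` degenerates at `E_s` once the differential of every element
of `V^p A` lying in `V^{p+s} A` is the differential of an element of `V^{p+1} A`. -/
theorem degeneratesAt_of_exists_diff_eq {V : Filtration A} {s : ℤ}
    (h : ∀ p n : ℤ, ∀ x ∈ V.sub p n, diff A n x ∈ V.sub (p + s) (n + 1) →
      ∃ w ∈ V.sub (p + 1) n, diff A n x = diff A n w) : V.DegeneratesAt s := by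
  intro r hr p n
  refine Submodule.linearMap_qext _ (LinearMap.ext ?_)
  rintro ⟨x, hx, hdx⟩
  obtain ⟨w, hw, hd⟩ := h p n x hx (V.mem_of_le (by lia) hdx)
  refine (Submodule.Quotient.mk_eq_zero _).2 ?_
  refine Submodule.mem_sup_left ?_
  change diff A n x ∈ V.B r (p + r) (n + 1)
  rw [hd]
  -- `B_r^{p+r}` consists of boundaries from `V^{(p+r)-r+1} = V^{p+1}`, where `w` lies.
  exact V.d_mem_B r p n w hw (by
    change diff A n w ∈ _
    rw [← hd]
    exact hdx)

theorem OpposedOnGr.degeneratesAt_two {F G W : Filtration A} (h : F.OpposedOnGr G W)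
    (hS : F.StrictOnGr W) (hF : F.Biregular) (hG : G.Biregular) (hW : W.Biregular) (i : ℤ) :
    (W.inducedOnGr F i).DegeneratesAt 2 := by
  refine degeneratesAt_of_exists_diff_eq ?_
  rintro p n _ ⟨⟨x, hxF⟩, hxW, rfl⟩ ⟨⟨z, hzF⟩, hzW, hz⟩
  have hzx : z - diff A n x ∈ F.sub (i + 1) (n + 1) :=
    (F.gr_mk_eq_iff ⟨z, hzF⟩ ⟨diff A n x, F.diff_mem hxF⟩).1 hz
  obtain ⟨w, hw, hdw⟩ := h.exists_diff_sub_mem hS hF hG hW i p n x ⟨hxF, hxW⟩ z hzW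
    (by rw [← neg_sub]; exact neg_mem hzx)
  exact ⟨_, ⟨⟨w, hw.1⟩, hw.2, rfl⟩,
    (F.gr_mk_eq_iff ⟨diff A n x, F.diff_mem hxF⟩ ⟨diff A n w, F.diff_mem hw.1⟩).2 hdw⟩

end Filtration
end HodgeCpx

theorem mainTheorem4 (K : CHodgeComplex.{u}) (i : ℤ) :
    (K.W.inducedOnGr K.F i).DegeneratesAt 2 := by
  have hS := HodgeCpx.Filtration.strictOnGr_of_strict K.strict_F
  have hS' := HodgeCpx.Filtration.strictOnGr_of_strict K.strict_F'
  exact (HodgeCpx.Filtration.opposedOnGr_of_isCompl hS hS'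
    fun a b p n => (K.hodge n p).opposed a b).degeneratesAt_two hS K.biregular_F K.biregular_F'
      K.biregular_W i
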